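/- Let $P\subset\mathbb{R}^d$ be a full-dimensional polytope (the convex hull of finitely many points, with affine span $\mathbb{R}^d$). For a $2$-dimensional face ($2$-face) $F$ of $P$, let $\mathrm{Span}[F]$ be the $2$-dimensional linear subspace parallel to $F$; two $2$-faces $F,F'$ are parallel if $\mathrm{Span}[F]=\mathrm{Span}[F']$, and the equivalence classes of this relation are called the classes of $2$-faces of $P$. For a linear subspace $W\subset\mathbb{R}^d$, a $2$-face $F$ is degenerated for $W$ if the orthogonal projection $\pi_W$ onto $W$ sends $F$ into a line (possibly onto a point), and a class of $2$-faces is degenerating for $W$ if one of its members (equivalently, each of them) is degenerated for $W$. A linear subspace $V\subset\mathbb{R}^d$ of codimension $2$ is an admissible orthogonal for $P$ if no class of $2$-faces of $P$ is degenerating for the plane $V^\perp$. Let $V_0$ and $V_1$ be two admissible orthogonals for $P$. Then there is a map $\gamma:[0,1]\to(\mathbb{R}^d)^{d-2}$ such that 1. $\gamma(t)$ is linearly independent for every $t\in[0,1]$, $\mathrm{Span}(\gamma(0))=V_0$ and $\mathrm{Span}(\gamma(1))=V_1$; 2. $\gamma$ is continuous except possibly at finitely many points $t_1<\dots<t_n$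 of $(0,1)$, at each of which it has one-sided limits $\gamma(t_i^-)$ and $\gamma(t_i^+)$ with $\mathrm{Span}(\gamma(t_i^-))=\mathrm{Span}(\gamma(t_i^+))=\mathrm{Span}(\gamma(t_i))$; 3. there are only finitely many $t\in[0,1]$ for which some class of $2$-faces of $P$ is degenerating for $\mathrm{Span}(\gamma(t))^\perp$, and for each such $t$ exactly one class of $2$-faces is degenerating. -/

import Mathlib

open Set Filter Topology

noncomputable section

/-- Euclidean space of dimension `d`. -/
abbrev Euc (d : ℕ) : Type := EuclideanSpace ℝ (Fin d)

/-- A full-dimensional polytope: the convex hull of finitely many points, not contained in any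
proper affine subspace. -/
def IsFullPolytope {d : ℕ} (P : Set (Euc d)) : Prop :=
  (∃ s : Set (Euc d), s.Finite ∧ P = convexHull ℝ s) ∧ affineSpan ℝ P = ⊤

/-- A 2-face of `P`: a face (the set of maximizers on `P` of some linear form) of dimension 2.
The linear subspace parallel to `F` is `vectorSpan ℝ F`. -/
def IsTwoFace {d : ℕ} (P F : Set (Euc d)) : Prop :=
  IsExposed ℝ P F ∧ Module.finrank ℝ (vectorSpan ℝ F) = 2

/-- The class of `F`: all the 2-faces of `P` that are parallel to `F`. -/
def twoFaceClass {d : ℕ} (P F : Set (Euc d)) : Set (Set (Euc d)) :=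
  {G | IsTwoFace P G ∧ vectorSpan ℝ G = vectorSpan ℝ F}

/-- `F` is degenerated for `W`: the orthogonal projection on `W` sends `F` into a line
(possibly to a point). -/
def IsDegenerated {d : ℕ} (W : Submodule ℝ (Euc d)) (F : Set (Euc d)) : Prop :=
  Collinear ℝ (W.starProjection '' F)

/-- The classes of parallel 2-faces of `P` that are degenerating for `W`, that is, those of which
some representative is degenerated for `W`. -/
def degeneratingClasses {d : ℕ} (P : Set (Euc d)) (W : Submodule ℝ (Euc d)) :
    Set (Set (Set (Euc d))) :=
  {c | ∃ F, IsTwoFace P F ∧ IsDegenerated W F ∧ c = twoFaceClass P F}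

/-- An admissible plane for `P`: a 2-dimensional subspace for which no class of 2-faces of `P`
is degenerating. -/
def IsAdmissiblePlane {d : ℕ} (P : Set (Euc d)) (W : Submodule ℝ (Euc d)) : Prop :=
  Module.finrank ℝ W = 2 ∧ degeneratingClasses P W = ∅

/-- An admissible orthogonal for `P`: a subspace whose orthogonal is an admissible plane; in
particular it has dimension `d - 2`. -/
def IsAdmissibleOrthogonal {d : ℕ} (P : Set (Euc d)) (V : Submodule ℝ (Euc d)) : Prop :=
  IsAdmissiblePlane P Vᗮ

/-- The span of a family of `k` vectors. -/
def famSpan {d k : ℕ} (u : Fin k → Euc d) : Submodule ℝ (Euc d) :=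
  Submodule.span ℝ (Set.range u)

/-- `γ`, restricted to `[0, 1]`, is a continuous arc of free families of `k` vectors from `V₀` to
`V₁`. A finite number of changes of basis is allowed at times in `(0, 1)`. -/
structure IsArc {d k : ℕ} (V₀ V₁ : Submodule ℝ (Euc d)) (γ : ℝ → Fin k → Euc d) : Prop where
  free : ∀ t ∈ Icc (0 : ℝ) 1, LinearIndependent ℝ (γ t)
  source : famSpan (γ 0) = V₀
  target : famSpan (γ 1) = V₁
  continuous_except : ∃ S : Set ℝ, S.Finite ∧ S ⊆ Ioo 0 1 ∧
    (∀ t ∈ Icc (0 : ℝ) 1 \ S, ContinuousWithinAt γ (Icc 0 1) t) ∧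
    ∀ t ∈ S, ∃ l r : Fin k → Euc d,
      Tendsto γ (𝓝[<] t) (𝓝 l) ∧ Tendsto γ (𝓝[>] t) (𝓝 r) ∧
      famSpan l = famSpan (γ t) ∧ famSpan r = famSpan (γ t)

/-- The times in `[0, 1]` at which some class of 2-faces of `P` is degenerating for the projection
on the plane orthogonal to the span of `γ t`. -/
def degenerationTimes {d k : ℕ} (P : Set (Euc d)) (γ : ℝ → Fin k → Euc d) : Set ℝ :=
  {t | t ∈ Icc (0 : ℝ) 1 ∧ (degeneratingClasses P (famSpan (γ t))ᗮ).Nonempty}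

end

/-!
A 2-face `F` is degenerated for `Vᗮ` exactly if its direction plane `L` meets `V`. If `u` is a basis
of `V` and `a` a basis of `L`, this means that the determinant of `u` completed by `a` vanishes;
for fixed `a` this determinant is a multilinear form `D_L` in `u` (`planeForm`). There are finitely
many planes `L`, one for each class of 2-faces. So it is enough to join a basis of `V₀` to a basis
of `V₁` by a path of free families along which the forms `D_L` have finitely many zeros and no two
of them vanish together; this path has no discontinuity at all.

The path moves one vector at a time along a segment, on which each `D_L` is affine in the time and
nonzero at the start, hence has at most one zero. Once the other vectors are fixed, `D_L` and `D_L'`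
are linear forms of the moving vector, and as long as these are not proportional, a segment to
almost every end point avoids their common kernel (`IsGenericFamily.ae_joined_update`). That the
forms are nonzero and not proportional, in each slot, is the genericity condition
`IsGenericFamily`; it says that certain multilinear expressions are nonzero, so it survives almost
every change of a vector (`IsGenericFamily.ae_update`). Hence two generic families can have their
vectors replaced one after the other by the same vectors (`IsGenericFamily.joined`). Finally, a
complement of all the planes `L` has a generic basis (`exists_isGenericFamily`), since genericity of
a basis amounts to finitely many nonzero vectors having nonzero coordinates in it.
-/

noncomputable section

/-! ### Paths meeting a set finitely often -/

/-- `x` and `y` are joined by a path that stays in `A` and is in `B` at only finitely many times. -/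
def JoinedMeetingFinitely {X : Type*} [TopologicalSpace X] (A B : Set X) (x y : X) : Prop :=
  ∃ γ : Path x y, (∀ t, γ t ∈ A) ∧ {t | γ t ∈ B}.Finite

namespace JoinedMeetingFinitely

variable {X : Type*} [TopologicalSpace X] {A B : Set X} {x y z : X}

theorem refl (hA : x ∈ A) (hB : x ∉ B) : JoinedMeetingFinitely A B x x :=
  ⟨Path.refl x, fun _ => hA, by simp [hB]⟩

theorem symm (h : JoinedMeetingFinitely A B x y) : JoinedMeetingFinitely A B y x := by
  obtain ⟨γ, hA, hB⟩ := h
  refine ⟨γ.symm, fun t => hA _, ?_⟩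
  exact hB.preimage (f := unitInterval.symm) unitInterval.symm_bijective.injective.injOn

theorem trans (h : JoinedMeetingFinitely A B x y) (h' : JoinedMeetingFinitely A B y z) :
    JoinedMeetingFinitely A B x z := by
  obtain ⟨γ, hA, hB⟩ := h
  obtain ⟨γ', hA', hB'⟩ := h'
  refine ⟨γ.trans γ', fun t => ?_, ?_⟩
  · rw [Path.trans_apply]
    split_ifs
    · exact hA _
    · exact hA' _
  · have h₁ : ((fun t : unitInterval => (t : ℝ) / 2) '' {t | γ t ∈ B}).Finite := hB.image _
    have h₂ : ((fun t : unitInterval => ((t : ℝ) + 1) / 2) '' {t | γ' t ∈ B}).Finite :=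
      hB'.image _
    refine ((h₁.union h₂).preimage (f := ((↑) : unitInterval → ℝ))
      Subtype.val_injective.injOn).subset fun t ht => ?_
    rw [mem_ofPred_eq, Path.trans_apply] at ht
    split_ifs at ht
    · exact Or.inl ⟨_, ht, by simp⟩
    · exact Or.inr ⟨_, ht, by simp⟩

end JoinedMeetingFinitely

/-! ### Generic vectors and generic families -/

open MeasureTheory

theorem ae_notMem_submodule {d : ℕ} {p : Submodule ℝ (Euc d)} (hp : p ≠ ⊤) :
    ∀ᵐ y : Euc d, y ∉ p :=
  measure_eq_zero_iff_ae_notMem.1 (Measure.addHaar_submodule volume p hp)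

theorem ae_linearMap_ne_zero {d : ℕ} {φ : Euc d →ₗ[ℝ] ℝ} {x : Euc d} (hx : φ x ≠ 0) :
    ∀ᵐ y : Euc d, φ y ≠ 0 :=
  ae_notMem_submodule (p := φ.ker) fun h => hx (LinearMap.mem_ker.1 (h ▸ Submodule.mem_top))

theorem LinearIndependent.update_of_notMem_span {K V ι : Type*} [DivisionRing K] [AddCommGroup V]
    [Module K V] [DecidableEq ι] {u : ι → V} (hu : LinearIndependent K u) (j : ι) {v : V}
    (hv : v ∉ Submodule.span K (range u)) : LinearIndependent K (Function.update u j v) := by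
  have h := (linearIndependent_option'.2 ⟨hu, hv⟩).comp
    (fun i => if i = j then none else some i) fun a b hab => by grind
  convert h using 1
  ext i
  by_cases hi : i = j <;> simp [hi]

/-- A free family `u` is generic for the forms `D i`, with respect to subspaces `L i` on which
`D i` vanishes in each of its arguments, if no `D i` vanishes at `u` and if, for each slot `j` and
`i ≠ i'`, the linear form `D i' (u₁, …, uⱼ₋₁, ·, uⱼ₊₁, …)` does not vanish on `L i`. The second
condition gives two forms with distinct kernels when all vectors of `u` but `u j` are fixed. -/
structure IsGenericFamily {d k : ℕ} {ι : Type*}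
    (D : ι → MultilinearMap ℝ (fun _ : Fin k => Euc d) ℝ) (L : ι → Submodule ℝ (Euc d))
    (u : Fin k → Euc d) : Prop where
  free : LinearIndependent ℝ u
  ne_zero : ∀ i, D i u ≠ 0
  exists_mem : ∀ j i i', i ≠ i' → ∃ l ∈ L i, D i' (Function.update u j l) ≠ 0

/-- The free families at which at most one of the forms `D i` vanishes. -/
def atMostOneZero {d k : ℕ} {ι : Type*} (D : ι → MultilinearMap ℝ (fun _ : Fin k => Euc d) ℝ) :
    Set (Fin k → Euc d) :=
  {u | LinearIndependent ℝ u ∧ ∀ i i', D i u = 0 → D i' u = 0 → i = i'}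

/-- The families at which some form `D i` vanishes. -/
def someZero {d k : ℕ} {ι : Type*} (D : ι → MultilinearMap ℝ (fun _ : Fin k => Euc d) ℝ) :
    Set (Fin k → Euc d) :=
  {u | ∃ i, D i u = 0}

section Moves

variable {d k : ℕ} {ι : Type*} [Finite ι]
  {D : ι → MultilinearMap ℝ (fun _ : Fin k => Euc d) ℝ} {L : ι → Submodule ℝ (Euc d)}

theorem span_range_ne_top_of_lt (hk : k < d) (u : Fin k → Euc d) :
    Submodule.span ℝ (range u) ≠ ⊤ := by
  intro h
  have h₁ := finrank_range_le_card (R := ℝ) u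
  rw [Set.finrank, h, finrank_top, finrank_euclideanSpace_fin, Fintype.card_fin] at h₁
  omega

theorem IsGenericFamily.ae_update (hk : k < d) {u : Fin k → Euc d} (hu : IsGenericFamily D L u)
    (j : Fin k) : ∀ᵐ y : Euc d, IsGenericFamily D L (Function.update u j y) := by
  have h₁ : ∀ᵐ y : Euc d, ∀ i, D i (Function.update u j y) ≠ 0 := by
    refine ae_all_iff.2 fun i => ?_
    refine ae_linearMap_ne_zero (φ := (D i).toLinearMap u j) (x := u j) ?_
    simpa using hu.ne_zero i
  have h₂ : ∀ᵐ y : Euc d, ∀ m i i', i ≠ i' →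
      ∃ l ∈ L i, D i' (Function.update (Function.update u j y) m l) ≠ 0 := by
    refine ae_all_iff.2 fun m => ae_all_iff.2 fun i => ae_all_iff.2 fun i' => ?_
    by_cases hi : i = i'
    · simp [hi]
    obtain ⟨l, hl, hne⟩ := hu.exists_mem m i i' hi
    by_cases hm : m = j
    -- The value in the slot `j` is overwritten by `l`, so `y` plays no role.
    · subst hm
      exact .of_forall fun y _ => ⟨l, hl, by simpa using hne⟩
    · have h := ae_linearMap_ne_zero (φ := (D i').toLinearMap (Function.update u m l) j)
        (x := u j) (by simpa [Function.update_comm hm, Function.update_eq_self] using hne)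
      filter_upwards [h] with y hy _
      exact ⟨l, hl, by simpa [Function.update_comm hm] using hy⟩
  filter_upwards [h₁, h₂, ae_notMem_submodule (span_range_ne_top_of_lt hk u)] with y hy₁ hy₂ hy₃
  exact ⟨hu.free.update_of_notMem_span j hy₃, hy₁, hy₂⟩

/-- Moving the vector `u j` of a generic family straight to a generic vector `y` is allowed. Along
the segment each `D i` is an affine function of time, and `D i`, `D i'` vanish together only
if `y` is in the kernel of `D i (u) D i' (·) - D i' (u) D i (·)`, a nonzero form of the slot `j`. -/
theorem IsGenericFamily.ae_joined_update (hk : k < d)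
    (hL : ∀ i u j, ∀ l ∈ L i, D i (Function.update u j l) = 0) {u : Fin k → Euc d}
    (hu : IsGenericFamily D L u) (j : Fin k) :
    ∀ᵐ y : Euc d,
      JoinedMeetingFinitely (atMostOneZero D) (someZero D) u (Function.update u j y) := by
  have h₁ : ∀ᵐ y : Euc d, ∀ i i', i ≠ i' →
      D i u * D i' (Function.update u j y) - D i' u * D i (Function.update u j y) ≠ 0 := by
    refine ae_all_iff.2 fun i => ae_all_iff.2 fun i' => ?_
    by_cases hi : i = i'
    · simp [hi]
    obtain ⟨l, hl, hne⟩ := hu.exists_mem j i i' hi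
    have h := ae_linearMap_ne_zero (x := l)
      (φ := D i u • (D i').toLinearMap u j - D i' u • (D i).toLinearMap u j)
      (by simpa [hL i u j l hl] using ⟨hu.ne_zero i, hne⟩)
    filter_upwards [h] with y hy _
    simpa using hy
  filter_upwards [h₁, ae_notMem_submodule (span_range_ne_top_of_lt hk u)] with y hy hyu
  let c : ℝ → Fin k → Euc d := fun t => Function.update u j (u j + t • (y - u j))
  have hD (i : ι) (t : ℝ) : D i (c t) = (1 - t) * D i u + t * D i (Function.update u j y) := by
    have h₀ : D i (Function.update u j (u j)) = D i u := by simp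
    simp only [c, MultilinearMap.map_update_add, MultilinearMap.map_update_smul,
      MultilinearMap.map_update_sub, h₀, smul_eq_mul]
    ring
  have hc : Continuous c := by fun_prop
  let γ : Path u (Function.update u j y) :=
    { toFun := fun t => c t
      continuous_toFun := by fun_prop
      source' := by simp [c]
      target' := by simp [c] }
  have hγ (t : unitInterval) : γ t = c t := rfl
  refine ⟨γ, fun t => ⟨?_, fun i i' hi hi' => ?_⟩, ?_⟩
  · rw [hγ]
    by_cases ht : (t : ℝ) = 0
    · simpa [c, ht] using hu.free
    refine hu.free.update_of_notMem_span j fun hmem => hyu ?_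
    have huj : u j ∈ Submodule.span ℝ (range u) := Submodule.subset_span ⟨j, rfl⟩
    have h := (Submodule.smul_mem_iff _ ht).1 ((Submodule.add_mem_iff_right _ huj).1 hmem)
    simpa using Submodule.add_mem _ h huj
  -- Eliminating between the two affine equations leaves `t` times the form excluded by `hy`.
  · by_contra hne
    rw [hγ, hD] at hi hi'
    have ht : (t : ℝ) ≠ 0 := by
      intro ht
      rw [ht] at hi
      exact hu.ne_zero i (by simpa using hi)
    refine hy i i' hne ((mul_eq_zero.1 ?_).resolve_left ht)
    linear_combination D i u * hi' - D i' u * hi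
  · have hsub : {t | γ t ∈ someZero D} ⊆ ⋃ i, {t | D i (γ t) = 0} := fun t ht => by
      simpa [someZero] using ht
    refine (finite_iUnion fun i => ?_).subset hsub
    refine Subsingleton.finite fun s hs t ht => ?_
    rw [mem_ofPred_eq, hγ, hD] at hs ht
    by_contra hne
    have hst : (t : ℝ) - s ≠ 0 := sub_ne_zero.2 fun h => hne (Subtype.ext h.symm)
    refine hu.ne_zero i ((mul_eq_zero.1 ?_).resolve_left hst)
    linear_combination (t : ℝ) * hs - (s : ℝ) * ht

/-- Two generic families are joined: their vectors are replaced one after the other by the same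
vectors, generic for both families. -/
theorem IsGenericFamily.joined (hk : k < d)
    (hL : ∀ i u j, ∀ l ∈ L i, D i (Function.update u j l) = 0) {u w : Fin k → Euc d}
    (hu : IsGenericFamily D L u) (hw : IsGenericFamily D L w) :
    JoinedMeetingFinitely (atMostOneZero D) (someZero D) u w := by
  have key (s : Finset (Fin k)) : ∃ u' w', IsGenericFamily D L u' ∧ IsGenericFamily D L w' ∧
      JoinedMeetingFinitely (atMostOneZero D) (someZero D) u u' ∧
      JoinedMeetingFinitely (atMostOneZero D) (someZero D) w w' ∧ ∀ j ∈ s, u' j = w' j := by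
    have hrefl {v : Fin k → Euc d} (hv : IsGenericFamily D L v) :
        JoinedMeetingFinitely (atMostOneZero D) (someZero D) v v :=
      .refl ⟨hv.free, fun i _ hi _ => absurd hi (hv.ne_zero i)⟩ fun ⟨i, hi⟩ => hv.ne_zero i hi
    induction s using Finset.induction_on with
    | empty => exact ⟨u, w, hu, hw, hrefl hu, hrefl hw, by simp⟩
    | insert j s _ ih =>
      obtain ⟨u', w', hu', hw', huu', hww', heq⟩ := ih
      obtain ⟨y, ⟨hy₁, hy₂⟩, hy₃, hy₄⟩ :=
        (((hu'.ae_update hk j).and (hu'.ae_joined_update hk hL j)).and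
          ((hw'.ae_update hk j).and (hw'.ae_joined_update hk hL j))).exists
      refine ⟨_, _, hy₁, hy₃, huu'.trans hy₂, hww'.trans hy₄, fun m hm => ?_⟩
      by_cases hmj : m = j
      · subst hmj
        simp
      · simpa [hmj] using heq m ((Finset.mem_insert.1 hm).resolve_left hmj)
  obtain ⟨u', w', -, -, huu', hww', heq⟩ := key Finset.univ
  obtain rfl : u' = w' := funext fun j => heq j (Finset.mem_univ j)
  exact huu'.trans hww'.symm

end Moves

/-! ### Generic bases of a subspace -/

/-- A finite set of nonzero vectors has nonzero coordinates in some basis: change an arbitrary basis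
by a Vandermonde matrix, which turns the coordinates of a vector into the values at `k` distinct
points of a nonzero polynomial. -/
theorem exists_basis_repr_ne_zero {V : Type*} [AddCommGroup V] [Module ℝ V] {k : ℕ}
    (b : Module.Basis (Fin k) ℝ V) {S : Set V} (hS : S.Finite) (h0 : (0 : V) ∉ S) :
    ∃ b' : Module.Basis (Fin k) ℝ V, ∀ v ∈ S, ∀ j, b'.repr v j ≠ 0 := by
  let p : V → Polynomial ℝ := fun v => ∑ m : Fin k, Polynomial.monomial m (b.repr v m)
  have hp (v : V) (hv : v ∈ S) : p v ≠ 0 := by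
    intro h
    have hrepr : b.repr v = 0 := by
      ext m
      have hm := congrArg (fun q => Polynomial.coeff q m) h
      simpa [p, Polynomial.finsetSum_coeff, Polynomial.coeff_monomial, Fin.val_inj] using hm
    exact h0 ((b.repr.map_eq_zero_iff.1 hrepr) ▸ hv)
  have hfin : (⋃ v ∈ S, {t : ℝ | (p v).IsRoot t}).Finite :=
    hS.biUnion fun v hv => Polynomial.finite_setOfPred_isRoot (hp v hv)
  let f := hfin.infinite_compl.natEmbedding
  let s : Fin k → ℝ := fun j => f j
  have hs : Function.Injective s := fun i j hij => Fin.val_injective (f.injective (Subtype.ext hij))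
  have hdet : IsUnit (Matrix.vandermonde s).det :=
    (Matrix.det_vandermonde_ne_zero_iff.2 hs).isUnit
  let A : (Fin k → ℝ) ≃ₗ[ℝ] (Fin k → ℝ) :=
    (Matrix.vandermonde s).toLinearEquiv' (Matrix.invertibleOfIsUnitDet _ hdet)
  refine ⟨.ofEquivFun (b.equivFun.trans A), fun v hv j hj => ?_⟩
  have hroot : (p v).IsRoot (s j) := by
    have hA : A (b.equivFun v) j = 0 := by simpa using hj
    have hA' : (Matrix.vandermonde s).mulVec (b.equivFun v) j = 0 := hA
    simpa [p, Polynomial.eval_finsetSum, Matrix.mulVec, dotProduct, Matrix.vandermonde_apply,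
      mul_comm] using hA'
  exact (f j).2 (mem_biUnion hv hroot)

/-! ### The form that detects the subspaces meeting a plane -/

/-- The determinant of the family `u` completed by the pair `a`, as a multilinear form in `u`. It
vanishes at a free family `u` exactly if the span of `u` meets the plane spanned by `a`. -/
def planeForm {d k : ℕ} (e : Module.Basis (Fin k ⊕ Fin 2) ℝ (Euc d)) (a : Fin 2 → Euc d) :
    MultilinearMap ℝ (fun _ : Fin k => Euc d) ℝ where
  toFun u := e.det (Sum.elim u a)
  map_update_add' {inst} u j x y := by
    obtain rfl : inst = instDecidableEqFin k := Subsingleton.elim _ _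
    simp only [Sum.elim_update_left, AlternatingMap.map_update_add]
  map_update_smul' {inst} u j c x := by
    obtain rfl : inst = instDecidableEqFin k := Subsingleton.elim _ _
    simp only [Sum.elim_update_left, AlternatingMap.map_update_smul]

section PlaneForm

variable {d k : ℕ} (e : Module.Basis (Fin k ⊕ Fin 2) ℝ (Euc d)) {a : Fin 2 → Euc d}

theorem planeForm_ne_zero_iff {u : Fin k → Euc d} :
    planeForm e a u ≠ 0 ↔ LinearIndependent ℝ (Sum.elim u a) := by
  rw [← isUnit_iff_ne_zero]
  refine e.is_basis_iff_det.symm.trans ⟨And.left, fun h => ⟨h, ?_⟩⟩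
  exact h.span_eq_top_of_card_eq_finrank' (Module.finrank_eq_card_basis e).symm

theorem planeForm_eq_zero_iff (ha : LinearIndependent ℝ a) {u : Fin k → Euc d}
    (hu : LinearIndependent ℝ u) :
    planeForm e a u = 0 ↔ ¬ Disjoint (famSpan u) (Submodule.span ℝ (range a)) := by
  rw [← not_iff_not, not_not, ← ne_eq, planeForm_ne_zero_iff, linearIndependent_sum]
  simp [hu, ha, famSpan]

theorem planeForm_update_eq_zero (u : Fin k → Euc d) (j : Fin k) {l : Euc d}
    (hl : l ∈ Submodule.span ℝ (range a)) : planeForm e a (Function.update u j l) = 0 := by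
  by_contra h
  rw [← ne_eq, planeForm_ne_zero_iff] at h
  have hd := (linearIndependent_sum.1 h).2.2
  simp only [Sum.elim_comp_inl, Sum.elim_comp_inr] at hd
  have hmem : l ∈ Submodule.span ℝ (range (Function.update u j l)) :=
    Submodule.subset_span ⟨j, by simp⟩
  refine h.ne_zero (Sum.inl j) ?_
  simpa using Submodule.disjoint_def.1 hd l hmem hl

/-- A subspace complementary to distinct planes has a generic basis. For planes `L ≠ L'`, take
`l ∈ L` outside of `L'`; its component `v ∈ V` along `L'` is not zero, and the form of `L'` takes
the same value at `l` and `v` in each slot, a nonzero one if the coordinates of `v` are nonzero. -/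
theorem exists_isGenericFamily {ι : Type*} [Finite ι] {V : Submodule ℝ (Euc d)}
    (hV : Module.finrank ℝ V = k) {a : ι → Fin 2 → Euc d} (ha : ∀ i, LinearIndependent ℝ (a i))
    (hinj : Function.Injective fun i => Submodule.span ℝ (range (a i)))
    (hdisj : ∀ i, Disjoint V (Submodule.span ℝ (range (a i)))) :
    ∃ u : Fin k → Euc d, famSpan u = V ∧ IsGenericFamily (fun i => planeForm e (a i))
      (fun i => Submodule.span ℝ (range (a i))) u := by
  have hrank (i : ι) : Module.finrank ℝ (Submodule.span ℝ (range (a i))) = 2 := by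
    simpa using finrank_span_eq_card (ha i)
  have hsup (i : ι) : V ⊔ Submodule.span ℝ (range (a i)) = ⊤ := by
    refine Submodule.eq_top_of_disjoint _ _ ?_ (hdisj i)
    rw [hV, hrank, Module.finrank_eq_card_basis e]
    simp
  have hex (q : {q : ι × ι // q.1 ≠ q.2}) : ∃ v : V, v ≠ 0 ∧
      ∃ l ∈ Submodule.span ℝ (range (a q.1.1)),
        l - v ∈ Submodule.span ℝ (range (a q.1.2)) := by
    obtain ⟨⟨i, i'⟩, hne⟩ := q
    have hnle : ¬ Submodule.span ℝ (range (a i)) ≤ Submodule.span ℝ (range (a i')) := fun hle =>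
      hne (hinj (Submodule.eq_of_le_of_finrank_eq hle ((hrank i).trans (hrank i').symm)))
    obtain ⟨l, hl, hl'⟩ := SetLike.not_le_iff_exists.1 hnle
    obtain ⟨v, hv, w, hw, rfl⟩ :=
      Submodule.mem_sup.1 ((hsup i').symm ▸ Submodule.mem_top : l ∈ V ⊔ _)
    refine ⟨⟨v, hv⟩, fun h0 => hl' ?_, v + w, hl, by simpa using hw⟩
    have h0' : v = 0 := congrArg Subtype.val h0
    simpa [h0'] using hw
  choose v hv l hl hlv using hex
  obtain ⟨b, hb⟩ := exists_basis_repr_ne_zero (Module.finBasisOfFinrankEq ℝ V hV)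
    (finite_range v) fun ⟨q, hq⟩ => hv q hq
  have hfree {c : Fin k → V} (hc : LinearIndependent ℝ c) :
      LinearIndependent ℝ fun j => (c j : Euc d) := hc.map' V.subtype V.ker_subtype
  have hne {c : Fin k → V} (hc : LinearIndependent ℝ c) (i : ι) :
      planeForm e (a i) (fun j => (c j : Euc d)) ≠ 0 := by
    rw [ne_eq, planeForm_eq_zero_iff e (ha i) (hfree hc), not_not]
    refine (hdisj i).mono_left (Submodule.span_le.2 ?_)
    rintro _ ⟨j, rfl⟩
    exact (c j).2
  refine ⟨fun j => b j, ?_, hfree b.linearIndependent, hne b.linearIndependent,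
    fun j i i' hi => ⟨l ⟨(i, i'), hi⟩, hl ⟨(i, i'), hi⟩, ?_⟩⟩
  · have h := Submodule.map_span V.subtype (range b)
    rw [b.span_eq, Submodule.map_top, Submodule.range_subtype, ← range_comp] at h
    exact h.symm
  · have hc : LinearIndependent ℝ (Function.update b j (v ⟨(i, i'), hi⟩)) := by
      refine b.linearIndependent.update j _ ⟨1, one_mem _, b.repr (v ⟨(i, i'), hi⟩), ?_, by simp⟩
      exact mem_nonZeroDivisors_of_ne_zero (hb _ ⟨_, rfl⟩ j)
    have h₁ := hne hc i'
    have h₂ : (fun m => ((Function.update b j (v ⟨(i, i'), hi⟩) m : V) : Euc d)) =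
        Function.update (fun m => (b m : Euc d)) j (v ⟨(i, i'), hi⟩ : Euc d) :=
      Function.comp_update V.subtype b j _
    have h₃ := planeForm_update_eq_zero e (fun m => (b m : Euc d)) j (hlv ⟨(i, i'), hi⟩)
    rw [MultilinearMap.map_update_sub, sub_eq_zero] at h₃
    rw [h₂] at h₁
    rwa [h₃]

end PlaneForm

/-! ### Two-dimensional faces of a polytope -/

/-- An exposed face is determined by its extreme points, which belong to the generating set. -/
theorem finite_isExposed_convexHull {d : ℕ} {s : Set (Euc d)} (hs : s.Finite) :
    {F | IsExposed ℝ (convexHull ℝ s) F}.Finite := by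
  refine Finite.of_finite_image (f := fun F => F.extremePoints ℝ)
    (hs.finite_subsets.subset ?_) fun F hF G hG h => ?_
  · rintro _ ⟨F, hF, rfl⟩
    exact (hF.isExtreme.extremePoints_subset_extremePoints).trans extremePoints_convexHull_subset
  · have hcpt := hs.isCompact_convexHull ℝ
    have hcvx := convex_convexHull ℝ s
    rw [← closure_convexHull_extremePoints (IsExposed.isCompact hF hcpt) (IsExposed.convex hF hcvx),
      ← closure_convexHull_extremePoints (IsExposed.isCompact hG hcpt) (IsExposed.convex hG hcvx)]
    exact congrArg (fun t => closure (convexHull ℝ t)) h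

/-- The planes parallel to the 2-faces of `P`; they correspond to the classes of 2-faces. -/
def facePlanes {d : ℕ} (P : Set (Euc d)) : Set (Submodule ℝ (Euc d)) :=
  vectorSpan ℝ '' {F | IsTwoFace P F}

theorem finite_facePlanes {d : ℕ} {P : Set (Euc d)} (hP : IsFullPolytope P) :
    (facePlanes P).Finite := by
  obtain ⟨⟨s, hs, rfl⟩, -⟩ := hP
  exact ((finite_isExposed_convexHull hs).subset fun F hF => hF.1).image _

/-- The kernel of the projection on `Vᗮ` is `V`, so a 2-face is flattened exactly if its
direction plane meets `V`. -/
theorem isDegenerated_orthogonal_iff {d : ℕ} {V : Submodule ℝ (Euc d)} {F : Set (Euc d)}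
    (hF : Module.finrank ℝ (vectorSpan ℝ F) = 2) :
    IsDegenerated Vᗮ F ↔ ¬ Disjoint V (vectorSpan ℝ F) := by
  let p : Euc d →ₗ[ℝ] Euc d := Vᗮ.starProjection
  have himage : vectorSpan ℝ (Vᗮ.starProjection '' F) = (p.domRestrict (vectorSpan ℝ F)).range := by
    rw [LinearMap.range_domRestrict]
    exact (AffineMap.map_vectorSpan p.toAffineMap).symm
  have hker : p.ker = V := by
    rw [Submodule.ker_starProjection, Submodule.orthogonal_orthogonal]
  have hdisj : Disjoint V (vectorSpan ℝ F) ↔ (p.domRestrict (vectorSpan ℝ F)).ker = ⊥ := by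
    rw [disjoint_comm, Submodule.disjoint_iff_comap_eq_bot, LinearMap.ker_domRestrict, hker]
  have hadd := (p.domRestrict (vectorSpan ℝ F)).finrank_range_add_finrank_ker
  rw [IsDegenerated, collinear_iff_finrank_le_one, himage, hdisj, ← Submodule.finrank_eq_zero]
  omega

theorem mem_degeneratingClasses_orthogonal_iff {d : ℕ} {P : Set (Euc d)}
    {V : Submodule ℝ (Euc d)} {c : Set (Set (Euc d))} :
    c ∈ degeneratingClasses P Vᗮ ↔
      ∃ F, IsTwoFace P F ∧ ¬ Disjoint V (vectorSpan ℝ F) ∧ c = twoFaceClass P F :=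
  exists_congr fun _ => and_congr_right fun hF => by rw [isDegenerated_orthogonal_iff hF.2]

theorem nonempty_degeneratingClasses_orthogonal_iff {d : ℕ} {P : Set (Euc d)}
    {V : Submodule ℝ (Euc d)} :
    (degeneratingClasses P Vᗮ).Nonempty ↔ ∃ L ∈ facePlanes P, ¬ Disjoint V L := by
  simp only [Set.Nonempty, mem_degeneratingClasses_orthogonal_iff, facePlanes, exists_mem_image]
  exact ⟨fun ⟨_, F, hF, h, _⟩ => ⟨F, hF, h⟩, fun ⟨F, hF, h⟩ => ⟨_, F, hF, h, rfl⟩⟩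

theorem IsAdmissibleOrthogonal.disjoint {d : ℕ} {P : Set (Euc d)} {V L : Submodule ℝ (Euc d)}
    (hV : IsAdmissibleOrthogonal P V) (hL : L ∈ facePlanes P) : Disjoint V L := by
  by_contra h
  exact (nonempty_degeneratingClasses_orthogonal_iff.2 ⟨L, hL, h⟩).ne_empty hV.2

theorem IsAdmissibleOrthogonal.finrank_add_two {d : ℕ} {P : Set (Euc d)}
    {V : Submodule ℝ (Euc d)} (hV : IsAdmissibleOrthogonal P V) : Module.finrank ℝ V + 2 = d := by
  have h := V.finrank_add_finrank_orthogonal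
  rwa [hV.1, finrank_euclideanSpace_fin] at h

end

theorem theorem1 (d : ℕ) (P : Set (Euc d)) (hP : IsFullPolytope P)
    (V₀ V₁ : Submodule ℝ (Euc d))
    (h₀ : IsAdmissibleOrthogonal P V₀) (h₁ : IsAdmissibleOrthogonal P V₁) :
    ∃ γ : ℝ → Fin (d - 2) → Euc d,
      IsArc V₀ V₁ γ ∧
      (degenerationTimes P γ).Finite ∧
      ∀ t ∈ degenerationTimes P γ, ∃! c, c ∈ degeneratingClasses P (famSpan (γ t))ᗮ := by
  have hd₀ := h₀.finrank_add_two
  have hd₁ := h₁.finrank_add_two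
  have : Finite (facePlanes P) := finite_facePlanes hP
  have hrank (L : facePlanes P) : Module.finrank ℝ L.1 = 2 := by
    obtain ⟨_, F, hF, rfl⟩ := L
    exact hF.2
  -- `d - 2` is no truncated subtraction: `hd₀` gives `2 ≤ d`.
  let e : Module.Basis (Fin (d - 2) ⊕ Fin 2) ℝ (Euc d) :=
    (EuclideanSpace.basisFun (Fin d) ℝ).toBasis.reindex
      ((finCongr (by omega : d = d - 2 + 2)).trans finSumFinEquiv.symm)
  let a : facePlanes P → Fin 2 → Euc d := fun L j => Module.finBasisOfFinrankEq ℝ L.1 (hrank L) j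
  have ha (L : facePlanes P) : LinearIndependent ℝ (a L) :=
    (Module.finBasisOfFinrankEq ℝ L.1 (hrank L)).linearIndependent.map' L.1.subtype L.1.ker_subtype
  have hspan (L : facePlanes P) : Submodule.span ℝ (range (a L)) = L.1 := by
    have h := Submodule.map_span L.1.subtype (range (Module.finBasisOfFinrankEq ℝ L.1 (hrank L)))
    rw [Module.Basis.span_eq, Submodule.map_top, Submodule.range_subtype, ← range_comp] at h
    exact h.symm
  have hinj : Function.Injective fun L => Submodule.span ℝ (range (a L)) := by
    simpa only [hspan] using Subtype.val_injective
  obtain ⟨u, hu, hgu⟩ := exists_isGenericFamily e (V := V₀) (by omega) ha hinj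
    fun L => by simpa only [hspan] using h₀.disjoint L.2
  obtain ⟨w, hw, hgw⟩ := exists_isGenericFamily e (V := V₁) (by omega) ha hinj
    fun L => by simpa only [hspan] using h₁.disjoint L.2
  obtain ⟨γ, hγ, hfin⟩ := hgu.joined (by omega)
    (fun L x j l hl => planeForm_update_eq_zero e x j hl) hgw
  have hzero (t : unitInterval) (L : facePlanes P) :
      planeForm e (a L) (γ t) = 0 ↔ ¬ Disjoint (famSpan (γ t)) L.1 := by
    rw [planeForm_eq_zero_iff e (ha L) (hγ t).1, hspan]
  refine ⟨γ.extend, ⟨fun t ht => ?_, by simpa using hu, by simpa using hw, ∅, finite_empty,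
    empty_subset _, fun t _ => γ.continuous_extend.continuousWithinAt, by simp⟩, ?_, ?_⟩
  · rw [γ.extend_apply ht]
    exact (hγ ⟨t, ht⟩).1
  · refine (hfin.image Subtype.val).subset ?_
    rintro t ⟨ht, hne⟩
    obtain ⟨L, hL, hLt⟩ := nonempty_degeneratingClasses_orthogonal_iff.1 hne
    rw [γ.extend_apply ht] at hLt
    exact ⟨⟨t, ht⟩, ⟨⟨L, hL⟩, (hzero _ _).2 hLt⟩, rfl⟩
  · rintro t ⟨ht, c, hc⟩
    rw [γ.extend_apply ht] at hc ⊢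
    refine ⟨c, hc, fun c' hc' => ?_⟩
    obtain ⟨F, hF, hFt, rfl⟩ := mem_degeneratingClasses_orthogonal_iff.1 hc
    obtain ⟨G, hG, hGt, rfl⟩ := mem_degeneratingClasses_orthogonal_iff.1 hc'
    have h := (hγ ⟨t, ht⟩).2 ⟨_, G, hG, rfl⟩ ⟨_, F, hF, rfl⟩ ((hzero _ _).2 hGt)
      ((hzero _ _).2 hFt)
    have hFG : vectorSpan ℝ G = vectorSpan ℝ F := congrArg Subtype.val h
    rw [twoFaceClass, twoFaceClass, hFG]
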